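/- Let $X$ and $Y$ be topological spaces. $X$ is called $Y$-Tychonoff if for every closed $A\subseteq X$, every $y_0\in Y$ and every function $f:F\to Y$ on a finite set $F\subseteq X\setminus A$ there is a continuous $\bar f:X\to Y$ with $\bar f|_F=f$ and $\bar f(A)\subseteq\{y_0\}$. Let $C_p(X,Y)$ be the set of all continuous functions $X\to Y$ with the topology of pointwise convergence. For $\mathcal D\subseteq Y$, a subspace $H\subseteq C_p(X,Y)$ is called a relatively $\mathcal D_p$-Tychonoff subspace of $C_p(X,Y)$ if for every closed $A\subseteq X$, every finite $F\subseteq X\setminus A$, every $y_0\in\mathcal D$ and every $f\in C_p(X,Y)$ with $f(F)\subseteq\mathcal D$ there is $\bar f\in H$ with $\bar f|_F=f|_F$ and $\bar f(A)\subseteq\{y_0\}$. A family $\mathcal U$ of open subsets of $X$ is an open $\omega$-cover of $X$ if every finite subset of $X$ is contained in some $U\in\mathcal U$; $X$ has property $\gamma$ if for every open $\omega$-cover $\mathcal U$ of $X$ there is a sequence $(U_n)_{n\in\omega}$ (repetitions allowed) of members of $\mathcal U$ with $\bigcup_{n}\bigcap_{i\ge n}U_i=X$. A space is a $k$-space if each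 of its non-closed subsets $B$ admits a compact subset $K$ such that $B\cap K$ is not closed in $K$. Theorem. Let $Y$ be a non-compact metrizable space and let $X$ be a $Y$-Tychonoff space. Let $(g_n)_{n\in\omega}$ be a sequence of pairwise distinct points of $Y$ such that $\mathcal D=\{g_n:n\in\omega\}$ is a closed discrete subspace of $Y$, and let $H$ be a relatively $\mathcal D_p$-Tychonoff subspace of $C_p(X,Y)$ containing the constant function $\mathbf g_0$ with value $g_0$. Then the following assertions are equivalent: (i) $H$ is a Fréchet–Urysohn space; (ii) $H$ is a sequential space; (iii) $H$ is a $k$-space; (iv) $X$ has property $\gamma$. -/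

import Mathlib

open Set Filter Topology

/-- `X` is `Y`-Tychonoff: for every closed `A`, every point `y₀` of `Y` and every function on a
finite set `F` disjoint from `A`, there is a continuous function `X → Y` that extends the given
function and is equal to `y₀` on `A`. (A function on `F` is given as the restriction of an
arbitrary function `f : X → Y`; this is no restriction since `y₀` witnesses that `Y` is
nonempty.) -/
def IsTychonoffFor (X Y : Type*) [TopologicalSpace X] [TopologicalSpace Y] : Prop :=
  ∀ (A : Set X) (y₀ : Y) (F : Set X) (f : X → Y), IsClosed A → F.Finite → F ⊆ Aᶜ →
    ∃ fbar : X → Y, Continuous fbar ∧ EqOn fbar f F ∧ fbar '' A ⊆ {y₀}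

/-- For `D ⊆ Y` and sets `H ⊆ S` of functions `X → Y`, `H` is a relatively `D_p`-Tychonoff
subspace of `S`. -/
def IsRelativelyTychonoff {X Y : Type*} [TopologicalSpace X]
    (D : Set Y) (H S : Set (X → Y)) : Prop :=
  H ⊆ S ∧ ∀ (A F : Set X) (y₀ : Y) (f : X → Y), IsClosed A → F.Finite → F ⊆ Aᶜ → y₀ ∈ D →
    f ∈ S → f '' F ⊆ D → ∃ fbar ∈ H, EqOn fbar f F ∧ fbar '' A ⊆ {y₀}

/-- A family `𝒰` of sets is an `ω`-cover of `X`: every finite subset of `X` lies in a member. -/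
def IsOmegaCover {X : Type*} (𝒰 : Set (Set X)) : Prop :=
  ∀ A : Set X, A.Finite → ∃ U ∈ 𝒰, A ⊆ U

/-- A `p`-sequence: a sequence of sets, repetitions allowed, whose lower limit
`⋃ n, ⋂ i ≥ n, U i` is the whole of `X`. -/
def IsPSequence {X : Type*} (U : ℕ → Set X) : Prop :=
  (⋃ n, ⋂ i, ⋂ (_ : n ≤ i), U i) = univ

/-- Property `γ`: every open `ω`-cover of `X` contains a `p`-sequence. -/
def HasPropertyGamma (X : Type*) [TopologicalSpace X] : Prop :=
  ∀ 𝒰 : Set (Set X), (∀ U ∈ 𝒰, IsOpen U) → IsOmegaCover 𝒰 →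
    ∃ U : ℕ → Set X, (∀ n, U n ∈ 𝒰) ∧ IsPSequence U

/-! For (iii) ⇒ (iv), an open set `U` is coded by the functions in `H` that equal some `g n`, `n ≠
0`, off `U`; when `U` runs over an ω-cover, the constant `g 0` is in the closure of these functions.
Split an open ω-cover into countably many pieces, none an ω-cover, and give each piece its own `g
n`. The k-property produces a compact `K` meeting infinitely many of the resulting closures. The
projections of `K` are compact, so they meet the closed discrete set `range g` in finite sets, and
each point of `X` is bad for only finitely many of the pieces met
(`IsRelativelyTychonoff.exists_strictMono_omegaCovered`). For a countable ω-cover split into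
singletons this is a p-sequence.

To reach a countable ω-cover, the same lemma shows that locally finite families of finite subsets of
`X` are countable. A failure of countable tightness in a compact subset of `H` would yield an
ω₁-sequence with an uncountable such family. Hence compact subsets are countably tight, the
k-property carries this over to `H`, and ω-covers have countable ω-subcovers.

For (iv) ⇒ (i), the sets where some `f ∈ B` is close to a limit `h` form an ω-cover; deleting a
point `x n` from those of tolerance `1 / (n + 1)` forces the tolerances along a p-sequence to tend
to zero. -/

/-! ### Closures in the topology of pointwise convergence -/

theorem mem_closure_iff_forall_finset_dist {X Y : Type*} [MetricSpace Y] {H : Set (X → Y)}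
    {s : Set H} {h : H} :
    h ∈ closure s ↔
      ∀ (E : Finset X) (n : ℕ), ∃ f ∈ s, ∀ x ∈ E, dist (f.1 x) (h.1 x) < 1 / ((n : ℝ) + 1) := by
  constructor
  · intro hh E n
    have hopen : IsOpen {f : H | ∀ x ∈ E, dist (f.1 x) (h.1 x) < 1 / ((n : ℝ) + 1)} := by
      have : {f : H | ∀ x ∈ E, dist (f.1 x) (h.1 x) < 1 / ((n : ℝ) + 1)}
          = ⋂ x ∈ E, {f : H | dist (f.1 x) (h.1 x) < 1 / ((n : ℝ) + 1)} := by
        ext; simp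
      rw [this]
      refine isOpen_biInter_finset fun x _ => isOpen_lt ?_ continuous_const
      exact (((continuous_apply x).comp continuous_subtype_val).dist continuous_const)
    obtain ⟨f, hf, hfs⟩ := mem_closure_iff.1 hh _ hopen
      (fun x _ => by rw [dist_self]; positivity)
    exact ⟨f, hfs, hf⟩
  · intro hs
    rw [mem_closure_iff]
    rintro _ ⟨O, hO, rfl⟩ hhO
    obtain ⟨E, u, hu, hEu⟩ := isOpen_pi_iff.1 hO h.1 hhO
    have hball : ∀ x, ∃ n : ℕ, x ∈ E → Metric.ball (h.1 x) (1 / ((n : ℝ) + 1)) ⊆ u x := by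
      intro x
      by_cases hx : x ∈ E
      · obtain ⟨ε, hε, hb⟩ := Metric.isOpen_iff.1 (hu x hx).1 _ (hu x hx).2
        obtain ⟨n, hn⟩ := exists_nat_one_div_lt hε
        exact ⟨n, fun _ => (Metric.ball_subset_ball hn.le).trans hb⟩
      · exact ⟨0, fun h => absurd h hx⟩
    choose n hn using hball
    obtain ⟨f, hfs, hf⟩ := hs E (E.sup n)
    refine ⟨f, hEu fun x hx => hn x hx ?_, hfs⟩
    refine (hf x hx).trans_le (one_div_le_one_div_of_le (by positivity) ?_)
    have : n x ≤ E.sup n := Finset.le_sup hx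
    gcongr

theorem mem_closure_of_forall_finset_eqOn {X Y : Type*} [MetricSpace Y] {H : Set (X → Y)}
    {s : Set H} {h : H} (hs : ∀ E : Finset X, ∃ f ∈ s, ∀ x ∈ E, f.1 x = h.1 x) :
    h ∈ closure s := by
  refine mem_closure_iff_forall_finset_dist.2 fun E n => ?_
  obtain ⟨f, hf, hE⟩ := hs E
  exact ⟨f, hf, fun x hx => by rw [hE x hx, dist_self]; positivity⟩

/-- Approximate `h` within `1 / (n + 1)` on the first `n + 1` points of `S`; any cluster point in
`K` of these approximations agrees with `h` on all of `S`, and stays in `B` as a limit of a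
countable subset. -/
theorem exists_mem_eqOn_of_countable {X Y : Type*} [MetricSpace Y] {H : Set (X → Y)}
    {K B : Set H} (hK : IsCompact K) (hBK : B ⊆ K)
    (hB : ∀ C ⊆ B, C.Countable → closure C ⊆ B) {h : H} (hh : h ∈ closure B)
    {S : Set X} (hS : S.Countable) : ∃ f ∈ B, ∀ x ∈ S, f.1 x = h.1 x := by
  classical
  rcases S.eq_empty_or_nonempty with rfl | hne
  · obtain ⟨f, hf⟩ := closure_nonempty_iff.1 ⟨h, hh⟩
    exact ⟨f, hf, by simp⟩
  obtain ⟨s, rfl⟩ := hS.exists_eq_range hne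
  choose f hfB hf using fun n : ℕ =>
    mem_closure_iff_forall_finset_dist.1 hh ((Finset.range (n + 1)).image s) n
  obtain ⟨φ, -, hφ⟩ := hK.exists_mapClusterPt (f := atTop) (u := f)
    (tendsto_principal.2 (Eventually.of_forall fun n => hBK (hfB n)))
  refine ⟨φ, hB (range f) (range_subset_iff.2 hfB) (countable_range f) ?_, ?_⟩
  · exact isClosed_closure.mem_of_mapClusterPt hφ
      (Filter.Eventually.of_forall fun n => subset_closure (mem_range_self n))
  · rintro _ ⟨j, rfl⟩
    have h1 : MapClusterPt (φ.1 (s j)) atTop ((fun g : H => g.1 (s j)) ∘ f) :=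
      hφ.continuousAt_comp
        ((continuous_apply (s j)).comp continuous_subtype_val).continuousAt
    have h2 : Tendsto ((fun g : H => g.1 (s j)) ∘ f) atTop (𝓝 (h.1 (s j))) := by
      rw [tendsto_iff_dist_tendsto_zero]
      refine squeeze_zero' (Eventually.of_forall fun _ => dist_nonneg) ?_
        tendsto_one_div_add_atTop_nhds_zero_nat
      filter_upwards [eventually_ge_atTop j] with n hn
      refine (hf n (s j) ?_).le
      exact Finset.mem_image_of_mem s (Finset.mem_range.2 (by omega))
    have : (𝓝 (φ.1 (s j)) ⊓ 𝓝 (h.1 (s j))).NeBot := NeBot.mono h1 (inf_le_inf_left _ h2)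
    exact eq_of_nhds_neBot this

/-! ### Countable tightness of compact sets of continuous functions -/

/-- The tuples `q β` witness that `f` is a free sequence relative to `h`. They cannot accumulate at
`p`: a limit of the `f γ` that are far from `h` at `p` is continuous and differs from `h` near `p`,
yet agrees with `h` on the tuples. -/
theorem exists_mem_nhds_finite_of_free_sequence {X Y I : Type*} [TopologicalSpace X]
    [MetricSpace Y] [LinearOrder I] [WellFoundedLT I]
    {H : Set (X → Y)} (hHc : ∀ f ∈ H, Continuous f) {K : Set H} (hK : IsCompact K)
    {f : I → H} (hf : ∀ i, f i ∈ K) (h : H) {m : ℕ} {J : Set I} (q : J → Fin m → X)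
    {ε : ℝ} (hε : 0 < ε)
    (heq : ∀ (β : J) (γ : I), β.1 ≤ γ → ∀ i, (f γ).1 (q β i) = h.1 (q β i))
    (hfar : ∀ (β : J), ∀ γ < β.1, ∃ i, ε ≤ dist ((f γ).1 (q β i)) (h.1 (q β i)))
    (p : Fin m → X) : ∃ O ∈ 𝓝 p, {β : J | q β ∈ O}.Finite := by
  have hev : ∀ x : X, Continuous fun g : H => g.1 x := fun x =>
    (continuous_apply x).comp continuous_subtype_val
  set Γ : Set I := {γ | ∃ i, ε / 2 ≤ dist ((f γ).1 (p i)) (h.1 (p i))} with hΓ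
  -- If `Γ` dominates `T`, compactness gives one `g ∈ K` that is far from `h` at `p` and equals `h`
  -- on every `q β` with `β ∈ T`.
  have key : ∀ T : Set I, (∀ α ∈ T, ∃ γ ∈ Γ, α ≤ γ) →
      ∃ O ∈ 𝓝 p, ∀ β : J, β.1 ∈ T → q β ∉ O := by
    intro T hT
    rcases T.eq_empty_or_nonempty with rfl | hne
    · exact ⟨univ, univ_mem, by simp⟩
    have := hne.to_subtype
    let t : T → Set H := fun α => {g | g ∈ K ∧
      (∃ i, ε / 2 ≤ dist (g.1 (p i)) (h.1 (p i))) ∧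
      ∀ β : J, β.1 ≤ α.1 → ∀ i, g.1 (q β i) = h.1 (q β i)}
    have htc : ∀ α, IsClosed (t α) := by
      intro α
      refine hK.isClosed.inter (IsClosed.inter ?_ ?_)
      · have : {g : H | ∃ i, ε / 2 ≤ dist (g.1 (p i)) (h.1 (p i))}
            = ⋃ i, {g : H | ε / 2 ≤ dist (g.1 (p i)) (h.1 (p i))} := by
          ext; simp
        change IsClosed {g : H | ∃ i, ε / 2 ≤ dist (g.1 (p i)) (h.1 (p i))}
        rw [this]
        exact isClosed_iUnion_of_finite fun i =>
          isClosed_le continuous_const ((hev _).dist continuous_const)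
      · have : {g : H | ∀ β : J, β.1 ≤ α.1 → ∀ i, g.1 (q β i) = h.1 (q β i)}
            = ⋂ (β : J) (_ : β.1 ≤ α.1) (i), {g : H | g.1 (q β i) = h.1 (q β i)} := by
          ext; simp
        change IsClosed {g : H | ∀ β : J, β.1 ≤ α.1 → ∀ i, g.1 (q β i) = h.1 (q β i)}
        rw [this]
        exact isClosed_iInter fun β => isClosed_iInter fun _ => isClosed_iInter fun i =>
          isClosed_eq (hev _) continuous_const
    have hanti : Antitone t := fun a b hab g hg =>
      ⟨hg.1, hg.2.1, fun β hβ => hg.2.2 β (hβ.trans hab)⟩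
    obtain ⟨g, hg⟩ := IsCompact.nonempty_iInter_of_directed_nonempty_isCompact_isClosed t
      hanti.directed_ge
      (fun α => by
        obtain ⟨γ, hγ, hle⟩ := hT α α.2
        exact ⟨f γ, hf γ, hγ, fun β hβ => heq β γ (hβ.trans hle)⟩)
      (fun α => hK.of_isClosed_subset (htc α) fun g hg => hg.1) htc
    rw [mem_iInter] at hg
    obtain ⟨i, hi⟩ := (hg (Classical.arbitrary T)).2.1
    refine ⟨{p' | 0 < dist (g.1 (p' i)) (h.1 (p' i))}, ?_, ?_⟩
    · refine (isOpen_lt continuous_const ?_).mem_nhds 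
        ((half_pos hε).trans_le hi)
      exact ((hHc _ g.2).comp (continuous_apply i)).dist ((hHc _ h.2).comp (continuous_apply i))
    · intro β hβ hmem
      have := (hg ⟨β.1, hβ⟩).2.2 β le_rfl i
      simp only [mem_ofPred_eq, this, dist_self, lt_irrefl] at hmem
  -- If `Γ` has a least strict upper bound `δ`, `key` handles `β < δ`, while `f δ` is close to `h`
  -- near `p` and so excludes `β > δ`; at most `β = δ` remains.
  by_cases hN : ∃ δ : I, ∀ γ ∈ Γ, γ < δ
  · obtain ⟨δ, hδ, hmin⟩ := WellFounded.has_min (wellFounded_lt (α := I))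
      {δ : I | ∀ γ ∈ Γ, γ < δ} hN
    obtain ⟨O, hO, hOJ⟩ := key (Iio δ) (fun α hα => by
      by_contra! hcon
      exact hmin α hcon hα)
    refine ⟨O ∩ ⋂ i, {p' | dist ((f δ).1 (p' i)) (h.1 (p' i)) < ε},
      inter_mem hO (iInter_mem.2 fun i => ?_), ?_⟩
    · refine (isOpen_lt ?_ continuous_const).mem_nhds ?_
      · exact ((hHc _ (f δ).2).comp (continuous_apply i)).dist
          ((hHc _ h.2).comp (continuous_apply i))
      · by_contra hcon
        simp only [mem_ofPred_eq, not_lt] at hcon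
        exact lt_irrefl δ (hδ δ ⟨i, by linarith⟩)
    · refine Set.Subsingleton.finite ?_
      suffices hs : ∀ β : J, q β ∈ O ∩ ⋂ i, {p' | dist ((f δ).1 (p' i)) (h.1 (p' i)) < ε} →
          β.1 = δ from fun a ha b hb => Subtype.ext ((hs a ha).trans (hs b hb).symm)
      rintro β ⟨h1, h2⟩
      rcases lt_trichotomy β.1 δ with hlt | heq' | hgt
      · exact absurd h1 (hOJ β hlt)
      · exact heq'
      · obtain ⟨i, hi⟩ := hfar β δ hgt
        exact absurd (mem_iInter.1 h2 i) (not_lt.2 hi)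
  · push Not at hN
    obtain ⟨O, hO, hOJ⟩ := key univ (fun α _ => hN α)
    refine ⟨O, hO, ?_⟩
    convert finite_empty
    exact eq_empty_of_forall_notMem fun β hβ => hOJ β (mem_univ _) hβ

/-- If every locally finite family of finite subsets of `X` is countable, then the compact
subspaces of a space of continuous functions on `X` are countably tight. -/
theorem isClosed_of_countable_closure_subset {X Y : Type*} [TopologicalSpace X]
    [MetricSpace Y] {H : Set (X → Y)} (hHc : ∀ f ∈ H, Continuous f)
    (hLF : ∀ (J : Type) (F : J → Finset X), (∀ E : Finset X, ∃ U : Set X, IsOpen U ∧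
      (E : Set X) ⊆ U ∧ {i | (F i : Set X) ⊆ U}.Finite) → Countable J)
    {K B : Set H} (hK : IsCompact K) (hBK : B ⊆ K)
    (hB : ∀ C ⊆ B, C.Countable → closure C ⊆ B) : IsClosed B := by
  classical
  refine isClosed_of_closure_subset fun h hh => ?_
  by_contra hhB
  -- A finite tuple and a tolerance separating `h` from `C`. The statement is total in `C`, with
  -- junk values elsewhere, so that `Φ` can be used inside the recursion.
  have hfar : ∀ C : Set H, ∃ D : (Σ m : ℕ, Fin m → X) × ℕ, C ⊆ B → C.Countable →
      ∀ f ∈ C, ∃ i, 1 / ((D.2 : ℝ) + 1) ≤ dist (f.1 (D.1.2 i)) (h.1 (D.1.2 i)) := by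
    intro C
    by_cases hC : C ⊆ B ∧ C.Countable
    · have hnot : h ∉ closure C := fun hc => hhB (hB C hC.1 hC.2 hc)
      rw [mem_closure_iff_forall_finset_dist] at hnot
      push Not at hnot
      obtain ⟨E, n, hE⟩ := hnot
      refine ⟨(⟨E.card, fun i => (E.equivFin.symm i : X)⟩, n), fun _ _ f hf => ?_⟩
      obtain ⟨x, hx, hd⟩ := hE f hf
      exact ⟨E.equivFin ⟨x, hx⟩, by simpa using hd⟩
    · exact ⟨(⟨0, Fin.elim0⟩, 0), fun h1 h2 => absurd ⟨h1, h2⟩ hC⟩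
  have hnear : ∀ S : Set X, ∃ f : H, S.Countable → f ∈ B ∧ ∀ x ∈ S, f.1 x = h.1 x := by
    intro S
    by_cases hS : S.Countable
    · obtain ⟨f, hf⟩ := exists_mem_eqOn_of_countable hK hBK hB hh hS
      exact ⟨f, fun _ => hf⟩
    · exact ⟨h, fun h1 => absurd h1 hS⟩
  choose Φ hΦ using hfar
  choose Ψ hΨ using hnear
  -- A copy of ω₁: uncountable, with countable initial segments.
  let I : Type := (Order.succ Cardinal.aleph0.{0}).ord.ToType
  have hI : ∀ a : I, (Iio a).Countable := fun a => by
    rw [← Cardinal.le_aleph0_iff_set_countable, ← Order.lt_succ_iff]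
    have := Cardinal.mk_Iio_lt a (by simp [I])
    rwa [Cardinal.mk_ord_toType] at this
  have hunc : ¬ (univ : Set I).Countable := by
    rw [← Cardinal.le_aleph0_iff_set_countable, Cardinal.mk_univ, Cardinal.mk_ord_toType]
    exact not_le.2 (Order.lt_succ _)
  -- `f α` is chosen in `B` to agree with `h` on the tuples separating `h` from `{f γ | γ < β}`, for
  -- all `β ≤ α`; the case `β = α` is allowed since that tuple depends only on earlier terms.
  let f : I → H := (wellFounded_lt (α := I)).fix fun α rec =>
    Ψ (⋃ β : Iic α, range (Φ {g | ∃ γ, ∃ hγ : γ < β.1, g = rec γ (hγ.trans_le β.2)}).1.2)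
  let C : I → Set H := fun β => {g | ∃ γ, ∃ _ : γ < β, g = f γ}
  have hfeq : ∀ α, f α = Ψ (⋃ β : Iic α, range (Φ (C β.1)).1.2) := fun α =>
    (wellFounded_lt (α := I)).fix_eq _ α
  have hcount : ∀ α : I, (⋃ β : Iic α, range (Φ (C β.1)).1.2).Countable := fun α => by
    have : Countable (Iic α) := by
      rw [← Iio_union_right]
      exact ((hI α).union (countable_singleton α)).to_subtype
    exact countable_iUnion fun β => countable_range _
  have hfB : ∀ α, f α ∈ B := fun α => by
    rw [hfeq]; exact (hΨ _ (hcount α)).1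
  have hCB : ∀ β, C β ⊆ B := by
    rintro β _ ⟨γ, -, rfl⟩; exact hfB γ
  have hCc : ∀ β, (C β).Countable := fun β => by
    refine ((hI β).image f).mono ?_
    rintro _ ⟨γ, hγ, rfl⟩
    exact mem_image_of_mem f hγ
  have hdata : ∀ β : I, ∃ (m k : ℕ) (q : Fin m → X),
      (∀ γ, β ≤ γ → ∀ i, (f γ).1 (q i) = h.1 (q i)) ∧
      ∀ γ < β, ∃ i, 1 / ((k : ℝ) + 1) ≤ dist ((f γ).1 (q i)) (h.1 (q i)) := fun β => by
    refine ⟨_, _, (Φ (C β)).1.2, fun γ hγ i => ?_, fun γ hγ =>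
      hΦ (C β) (hCB β) (hCc β) (f γ) ⟨γ, hγ, rfl⟩⟩
    rw [hfeq γ]
    exact (hΨ _ (hcount γ)).2 _ (mem_iUnion.2 ⟨⟨β, hγ⟩, mem_range_self i⟩)
  choose m k q hq1 hq2 using hdata
  refine hunc ?_
  -- Fixing tuple length and tolerance splits ω₁ into countably many classes, so countability of
  -- each is a contradiction.
  have hcov : (univ : Set I) = ⋃ a : ℕ × ℕ, {β | m β = a.1 ∧ k β = a.2} := by
    ext β; simp
  rw [hcov]
  refine countable_iUnion fun ⟨m₀, k₀⟩ => ?_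
  set J : Set I := {β | m β = m₀ ∧ k β = k₀} with hJ
  have hdata' : ∀ β : J, ∃ q : Fin m₀ → X,
      (∀ γ, β.1 ≤ γ → ∀ i, (f γ).1 (q i) = h.1 (q i)) ∧
      ∀ γ < β.1, ∃ i, 1 / ((k₀ : ℝ) + 1) ≤ dist ((f γ).1 (q i)) (h.1 (q i)) := by
    rintro ⟨β, rfl, rfl⟩
    exact ⟨q β, hq1 β, hq2 β⟩
  choose q' hq1' hq2' using hdata'
  have hloc := exists_mem_nhds_finite_of_free_sequence hHc hK (fun i => hBK (hfB i)) h q'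
    (by positivity : (0 : ℝ) < 1 / ((k₀ : ℝ) + 1)) hq1' hq2'
  have hbox : ∀ p : Fin m₀ → X, ∃ O : Fin m₀ → Set X, (∀ i, IsOpen (O i)) ∧
      (∀ i, p i ∈ O i) ∧ {β : J | ∀ i, q' β i ∈ O i}.Finite := fun p => by
    obtain ⟨O, hO, hfin⟩ := hloc p
    obtain ⟨O', hO', hsub⟩ := isOpen_pi_iff'.1 isOpen_interior p (mem_interior_iff_mem_nhds.2 hO)
    refine ⟨O', fun i => (hO' i).1, fun i => (hO' i).2, hfin.subset fun β hβ => ?_⟩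
    have hmem : q' β ∈ interior O := hsub fun i _ => hβ i
    have hmemO : q' β ∈ O := interior_subset hmem
    exact hmemO
  choose O hOo hOp hOf using hbox
  refine countable_coe_iff.1 (hLF J (fun β => Finset.univ.image (q' β)) fun E => ?_)
  -- The neighbourhood of `e` lies in every box side centred at `e`, over all tuples `p` from `E`. A
  -- tuple `q' β` inside the union thus lies in the box of some `p`, and there are finitely many
  -- `p`.
  refine ⟨⋃ e : E, ⋂ (p : Fin m₀ → E) (i) (_ : p i = e), O (fun i => (p i : X)) i, ?_, ?_, ?_⟩
  · exact isOpen_iUnion fun e => isOpen_iInter_of_finite fun p => isOpen_iInter_of_finite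
      fun i => isOpen_iInter_of_finite fun _ => hOo _ i
  · intro e he
    refine mem_iUnion.2 ⟨⟨e, he⟩, ?_⟩
    simp only [mem_iInter]
    intro p i hpi
    have := hOp (fun i => (p i : X)) i
    simpa only [hpi] using this
  · refine (finite_iUnion fun p : Fin m₀ → E => hOf fun i => (p i : X)).subset fun β hβ => ?_
    have : ∀ i, ∃ e : E, ∀ (p : Fin m₀ → E) (j), p j = e →
        q' β i ∈ O (fun i => (p i : X)) j := fun i => by
      have := hβ (Finset.mem_coe.2 (Finset.mem_image_of_mem (q' β) (Finset.mem_univ i)))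
      simpa only [mem_iUnion, mem_iInter] using this
    choose e he using this
    exact mem_iUnion.2 ⟨e, fun i => he i e i rfl⟩

/-! ### From the k-property of `H` to property γ of `X` -/

theorem exists_forall_mem_ne_of_mem_closure {X Y : Type*} [TopologicalSpace Y] [T1Space Y]
    {H : Set (X → Y)} {s : Set H} {f : H} (hf : f ∈ closure s) {E : Set X} (hE : E.Finite)
    {y : Y} (hy : ∀ x ∈ E, f.1 x ≠ y) : ∃ f' ∈ s, ∀ x ∈ E, f'.1 x ≠ y := by
  have hopen : IsOpen (⋂ x ∈ E, {f' : H | f'.1 x ≠ y}) :=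
    hE.isOpen_biInter fun x _ =>
      isOpen_ne.preimage ((continuous_apply x).comp continuous_subtype_val)
  obtain ⟨f', h1, h2⟩ := mem_closure_iff.1 hf _ hopen (mem_iInter₂.2 hy)
  exact ⟨f', h2, mem_iInter₂.1 h1⟩

theorem IsRelativelyTychonoff.exists_eq_of_subset {X Y : Type*} [TopologicalSpace X]
    [TopologicalSpace Y] {g : ℕ → Y} {H : Set (X → Y)}
    (hH : IsRelativelyTychonoff (range g) H {f : X → Y | Continuous f})
    {U E : Set X} (hU : IsOpen U) (hE : E.Finite) (hEU : E ⊆ U) (n : ℕ) :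
    ∃ f : H, (∀ x ∈ E, f.1 x = g 0) ∧ ∀ x ∉ U, f.1 x = g n := by
  obtain ⟨f, hf, h1, h2⟩ := hH.2 Uᶜ E (g n) (fun _ => g 0) hU.isClosed_compl hE
    (by rwa [compl_compl]) (mem_range_self n) continuous_const
    (by rintro _ ⟨-, -, rfl⟩; exact mem_range_self 0)
  exact ⟨⟨f, hf⟩, h1, fun x hx => h2 (mem_image_of_mem f hx)⟩

/-- An open `ω`-cover of `X` that is a countable union of families `η n`, none of which is an
`ω`-cover: some of these families `ω`-cover the members of a sequence with lower limit `X`. -/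
theorem IsRelativelyTychonoff.exists_strictMono_omegaCovered {X Y : Type*} [TopologicalSpace X]
    [MetricSpace Y] {g : ℕ → Y} (hg_inj : Function.Injective g)
    (hg_closed : IsClosed (range g)) (hg_discrete : DiscreteTopology (range g))
    {H : Set (X → Y)} (hH : IsRelativelyTychonoff (range g) H {f : X → Y | Continuous f})
    (hg₀ : (fun _ : X => g 0) ∈ H) [CompactlyCoherentSpace H]
    {η : ℕ → Set (Set X)} (hopen : ∀ n, ∀ U ∈ η n, IsOpen U)
    (hcov : IsOmegaCover (⋃ n, η n)) (hnot : ∀ n, ¬ IsOmegaCover (η n)) :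
    ∃ (φ : ℕ → ℕ) (Z : ℕ → Set X), StrictMono φ ∧
      (∀ k, ∀ E : Set X, E.Finite → E ⊆ Z k → ∃ U ∈ η (φ k), E ⊆ U) ∧
      ∀ x, ∀ᶠ k in atTop, x ∈ Z k := by
  -- The shift to `n + 1` keeps these values away from `g 0`, and distinct pieces get distinct
  -- values.
  let B : ℕ → Set H := fun n => {f | ∃ U ∈ η n, ∀ x ∉ U, f.1 x = g (n + 1)}
  have hB : ∀ n, ∀ f ∈ closure (B n), ∀ E : Set X, E.Finite → (∀ x ∈ E, f.1 x ≠ g (n + 1)) →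
      ∃ U ∈ η n, E ⊆ U := by
    intro n f hf E hE hne
    obtain ⟨f', ⟨U, hU, hfU⟩, hf'⟩ := exists_forall_mem_ne_of_mem_closure hf hE hne
    exact ⟨U, hU, fun x hx => by_contra fun hxU => hf' x hx (hfU x hxU)⟩
  let c : H := ⟨fun _ => g 0, hg₀⟩
  have hcB : ∀ n, c ∉ closure (B n) := fun n hc => hnot n fun E hE =>
    hB n c hc E hE fun x _ h => absurd (hg_inj h) (by omega)
  have hc : c ∈ closure (⋃ n, closure (B n)) := by
    refine mem_closure_of_forall_finset_eqOn fun E => ?_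
    obtain ⟨U, hU, hEU⟩ := hcov E E.finite_toSet
    obtain ⟨n, hn⟩ := mem_iUnion.1 hU
    obtain ⟨f, h1, h2⟩ := hH.exists_eq_of_subset (hopen n U hn) E.finite_toSet hEU (n + 1)
    exact ⟨f, mem_iUnion.2 ⟨n, subset_closure ⟨U, hn, h2⟩⟩, h1⟩
  have hncl : ¬ IsClosed (⋃ n, closure (B n)) := fun hcl => by
    rw [hcl.closure_eq] at hc
    obtain ⟨n, hn⟩ := mem_iUnion.1 hc
    exact hcB n hn
  rw [CompactlyCoherentSpace.isClosed_iff] at hncl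
  push Not at hncl
  obtain ⟨K, hK, hKB⟩ := hncl
  -- Otherwise the trace on `K` would be a finite union of closed sets.
  have hinf : {n | (closure (B n) ∩ K).Nonempty}.Infinite := by
    intro hfin
    refine hKB ?_
    have : (Subtype.val ⁻¹' (⋃ n, closure (B n)) : Set K)
        = ⋃ n ∈ {n | (closure (B n) ∩ K).Nonempty}, Subtype.val ⁻¹' closure (B n) := by
      ext f
      simp only [mem_preimage, mem_iUnion, exists_prop, mem_ofPred_eq]
      exact ⟨fun ⟨n, hn⟩ => ⟨n, ⟨f, hn, f.2⟩, hn⟩, fun ⟨n, _, hn⟩ => ⟨n, hn⟩⟩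
    rw [this]
    exact hfin.isClosed_biUnion fun n _ => isClosed_closure.preimage continuous_subtype_val
  obtain ⟨φ, hφ, hφK⟩ := extraction_of_frequently_atTop (Nat.frequently_atTop_iff_infinite.2 hinf)
  choose f hfB hfK using hφK
  refine ⟨φ, fun k => {x | (f k).1 x ≠ g (φ k + 1)}, hφ,
    fun k E hE hsub => hB (φ k) (f k) (hfB k) E hE hsub, fun x => ?_⟩
  -- The values at `x` of members of `K` meet `range g` in a finite set, while the `g (φ k + 1)` are
  -- distinct; so `x ∉ Z k` for only finitely many `k`.
  have hKx : IsCompact ((fun f : H => f.1 x) '' K) :=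
    hK.image ((continuous_apply x).comp continuous_subtype_val)
  have hfin : (((fun f : H => f.1 x) '' K) ∩ range g).Finite :=
    (hKx.inter_right hg_closed).finite
      ((isDiscrete_iff_discreteTopology.2 hg_discrete).mono inter_subset_right)
  have hfin' : {k | (f k).1 x = g (φ k + 1)}.Finite := by
    refine (hfin.preimage (f := fun k => g (φ k + 1)) ?_).subset ?_
    · exact (hg_inj.comp ((add_left_injective 1).comp hφ.injective)).injOn
    · intro k hk
      exact ⟨⟨f k, hfK k, hk⟩, mem_range_self _⟩
  rw [← Nat.cofinite_eq_atTop]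
  exact hfin'.compl_mem_cofinite

/-- Let `η n` consist of the open sets containing at most `n` of the `F i`. Any set whose finite
subsets are covered by members of `η n` also contains only finitely many `F i`, and each `F i` is
eventually contained in `Z k`. -/
theorem countable_of_locallyFinite_finsets {X Y : Type*} [TopologicalSpace X]
    [MetricSpace Y] {g : ℕ → Y} (hg_inj : Function.Injective g)
    (hg_closed : IsClosed (range g)) (hg_discrete : DiscreteTopology (range g))
    {H : Set (X → Y)} (hH : IsRelativelyTychonoff (range g) H {f : X → Y | Continuous f})
    (hg₀ : (fun _ : X => g 0) ∈ H) [CompactlyCoherentSpace H]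
    {J : Type*} (F : J → Finset X) (hF : ∀ E : Finset X, ∃ U : Set X, IsOpen U ∧
      (E : Set X) ⊆ U ∧ {i | (F i : Set X) ⊆ U}.Finite) : Countable J := by
  let η : ℕ → Set (Set X) := fun n =>
    {U | IsOpen U ∧ {i | (F i : Set X) ⊆ U}.Finite ∧ {i | (F i : Set X) ⊆ U}.ncard ≤ n}
  have hfin : ∀ (n : ℕ) (Z : Set X), (∀ E : Set X, E.Finite → E ⊆ Z → ∃ U ∈ η n, E ⊆ U) →
      {i | (F i : Set X) ⊆ Z}.Finite := by
    intro n Z hZ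
    by_contra hinf
    -- The union of `n + 1` of the `F i` is a finite subset of `Z`, but no member of `η n` can
    -- contain it.
    obtain ⟨t, ht, hcard⟩ := Set.Infinite.exists_subset_card_eq hinf (n + 1)
    obtain ⟨U, ⟨-, hUf, hUn⟩, hEU⟩ := hZ (⋃ i ∈ t, (F i : Set X))
      (t.finite_toSet.biUnion fun i _ => (F i).finite_toSet) (iUnion₂_subset fun i hi => ht hi)
    have hle := Set.ncard_le_ncard (s := (t : Set J)) (t := {i | (F i : Set X) ⊆ U})
      (fun i hi => (subset_biUnion_of_mem (u := fun i => (F i : Set X)) hi).trans hEU) hUf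
    rw [Set.ncard_coe_finset] at hle
    omega
  by_cases hη : ∃ n, IsOmegaCover (η n)
  · obtain ⟨n, hn⟩ := hη
    have := hfin n univ fun E hE _ => hn E hE
    simp only [subset_univ] at this
    exact countable_univ_iff.1 (this.subset fun _ _ => trivial).countable
  push Not at hη
  obtain ⟨φ, Z, -, hZ, hlim⟩ := hH.exists_strictMono_omegaCovered hg_inj hg_closed hg_discrete hg₀
    (η := η) (fun n U hU => hU.1) (fun E hE => by
      obtain ⟨U, hU, hEU, hUf⟩ := hF hE.toFinset
      exact ⟨U, mem_iUnion.2 ⟨_, hU, hUf, le_rfl⟩, by simpa using hEU⟩) hη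
  refine countable_univ_iff.1 ((countable_iUnion fun k => (hfin (φ k) (Z k) (hZ k)).countable).mono
    fun i _ => ?_)
  obtain ⟨k, hk⟩ := ((F i).eventually_all.2 fun x _ => hlim x).exists
  exact mem_iUnion.2 ⟨k, hk⟩

/-- The set `B` of limits of countable subsets of `A` is closed on each compact set by countable
tightness, hence closed. So `c ∈ closure A` is already a limit of a countable part of `A`, which
names a countable subfamily. -/
theorem IsOmegaCover.exists_countable_subset {X Y : Type*} [TopologicalSpace X]
    [MetricSpace Y] {g : ℕ → Y} (hg_inj : Function.Injective g)
    (hg_closed : IsClosed (range g)) (hg_discrete : DiscreteTopology (range g))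
    {H : Set (X → Y)} (hH : IsRelativelyTychonoff (range g) H {f : X → Y | Continuous f})
    (hg₀ : (fun _ : X => g 0) ∈ H) [CompactlyCoherentSpace H]
    {𝒰 : Set (Set X)} (h𝒰 : IsOmegaCover 𝒰) (hopen : ∀ U ∈ 𝒰, IsOpen U) :
    ∃ 𝒱 ⊆ 𝒰, 𝒱.Countable ∧ IsOmegaCover 𝒱 := by
  let A : Set H := {f | ∃ U ∈ 𝒰, ∀ x ∉ U, f.1 x = g 1}
  let B : Set H := {f | ∃ C ⊆ A, C.Countable ∧ f ∈ closure C}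
  let c : H := ⟨fun _ => g 0, hg₀⟩
  have hBc : ∀ C ⊆ B, C.Countable → closure C ⊆ B := by
    intro C hC hCc f hf
    have hC' : ∀ f ∈ C, ∃ D ⊆ A, D.Countable ∧ f ∈ closure D := fun f hf => hC hf
    choose! D hDA hDc hD using hC'
    refine ⟨⋃ a ∈ C, D a, iUnion₂_subset fun a ha => hDA a ha, hCc.biUnion fun a ha => hDc a ha, ?_⟩
    refine closure_minimal (fun a ha => ?_) isClosed_closure hf
    exact closure_mono (subset_biUnion_of_mem (u := D) ha) (hD a ha)
  have hBcl : IsClosed B := by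
    rw [CompactlyCoherentSpace.isClosed_iff]
    intro K hK
    have hcl : IsClosed (B ∩ K) := by
      refine isClosed_of_countable_closure_subset (fun f hf => hH.1 hf)
        (fun J F hF => countable_of_locallyFinite_finsets hg_inj hg_closed hg_discrete hH hg₀ F hF)
        hK inter_subset_right fun C hC hCc => subset_inter ?_ ?_
      · exact hBc C (hC.trans inter_subset_left) hCc
      · exact closure_minimal (hC.trans inter_subset_right) hK.isClosed
    convert hcl.preimage (continuous_subtype_val (p := (· ∈ K))) using 1
    ext f
    simp
  have hcA : c ∈ closure A := by
    refine mem_closure_of_forall_finset_eqOn fun E => ?_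
    obtain ⟨U, hU, hEU⟩ := h𝒰 E E.finite_toSet
    obtain ⟨f, h1, h2⟩ := hH.exists_eq_of_subset (hopen U hU) E.finite_toSet hEU 1
    exact ⟨f, ⟨U, hU, h2⟩, h1⟩
  have hAB : A ⊆ B := fun f hf =>
    ⟨{f}, singleton_subset_iff.2 hf, countable_singleton f, subset_closure rfl⟩
  obtain ⟨C, hCA, hCc, hcC⟩ := closure_minimal hAB hBcl hcA
  have hCU : ∀ f ∈ C, ∃ U ∈ 𝒰, ∀ x ∉ U, f.1 x = g 1 := fun f hf => hCA hf
  choose! U hU𝒰 hU using hCU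
  refine ⟨U '' C, image_subset_iff.2 fun f hf => hU𝒰 f hf, hCc.image U, fun E hE => ?_⟩
  obtain ⟨f, hfC, hf⟩ := exists_forall_mem_ne_of_mem_closure hcC hE (y := g 1)
    fun x _ h => absurd (hg_inj h) (by omega)
  exact ⟨U f, mem_image_of_mem U hfC, fun x hx => by_contra fun hxU => hf x hx (hU f hfC x hxU)⟩

theorem hasPropertyGamma_of_compactlyCoherentSpace {X Y : Type*} [TopologicalSpace X]
    [MetricSpace Y] {g : ℕ → Y} (hg_inj : Function.Injective g)
    (hg_closed : IsClosed (range g)) (hg_discrete : DiscreteTopology (range g))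
    {H : Set (X → Y)} (hH : IsRelativelyTychonoff (range g) H {f : X → Y | Continuous f})
    (hg₀ : (fun _ : X => g 0) ∈ H) [CompactlyCoherentSpace H] : HasPropertyGamma X := by
  intro 𝒰 hopen h𝒰
  by_cases huniv : univ ∈ 𝒰
  · exact ⟨fun _ => univ, fun _ => huniv, eq_univ_of_forall fun x => by simp⟩
  obtain ⟨𝒱, h𝒱𝒰, h𝒱c, h𝒱⟩ :=
    h𝒰.exists_countable_subset hg_inj hg_closed hg_discrete hH hg₀ hopen
  obtain ⟨V, hV, -⟩ := h𝒱 ∅ finite_empty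
  obtain ⟨U, rfl⟩ := h𝒱c.exists_eq_range ⟨V, hV⟩
  have hU : ∀ n, U n ∈ 𝒰 := fun n => h𝒱𝒰 (mem_range_self n)
  -- A singleton `{U n}` is an ω-cover only if `U n = univ`, which has been excluded.
  obtain ⟨φ, Z, -, hZ, hlim⟩ := hH.exists_strictMono_omegaCovered hg_inj hg_closed hg_discrete hg₀
    (η := fun n => {U n}) (by rintro n _ rfl; exact hopen _ (hU n))
    (by rwa [iUnion_singleton_eq_range]) (fun n hn => huniv (by
      have : U n = univ := eq_univ_of_forall fun x => by
        obtain ⟨_, rfl, hx⟩ := hn {x} (finite_singleton x)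
        exact hx rfl
      exact this ▸ hU n))
  refine ⟨fun k => U (φ k), fun k => hU _, eq_univ_of_forall fun x => ?_⟩
  obtain ⟨N, hN⟩ := eventually_atTop.1 (hlim x)
  refine mem_iUnion.2 ⟨N, mem_iInter₂.2 fun k hk => ?_⟩
  obtain ⟨_, rfl, hx⟩ := hZ k {x} (finite_singleton x) (singleton_subset_iff.2 (hN k hk))
  exact hx rfl

/-! ### From property γ of `X` to the Fréchet–Urysohn property of `H` -/

theorem IsTychonoffFor.t1Space {X Y : Type*} [TopologicalSpace X] [TopologicalSpace Y]
    [T1Space Y] [Nontrivial Y] (hX : IsTychonoffFor X Y) : T1Space X := by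
  classical
  obtain ⟨a, b, hab⟩ := exists_pair_ne Y
  rw [t1Space_iff_exists_open]
  intro x y hxy
  obtain ⟨f, hf, hfeq, -⟩ := hX ∅ a {x, y} (fun z => if z = x then a else b) isClosed_empty
    (by simp) (by simp)
  refine ⟨f ⁻¹' {b}ᶜ, isOpen_compl_singleton.preimage hf, ?_, ?_⟩
  · have : f x = a := by simpa using hfeq (mem_insert x {y})
    simpa [this] using hab
  · have : f y = b := by simpa [hxy.symm] using hfeq (mem_insert_of_mem x (mem_singleton y))
    simp [this]

theorem HasPropertyGamma.frechetUrysohnSpace {X Y : Type*} [TopologicalSpace X] [T1Space X]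
    [MetricSpace Y] (hX : HasPropertyGamma X) {H : Set (X → Y)}
    (hHc : ∀ f ∈ H, Continuous f) : FrechetUrysohnSpace H := by
  cases finite_or_infinite X
  -- For finite `X`, `H` is a subspace of a finite power of `Y`, hence metrizable.
  · infer_instance
  refine ⟨fun B h hh => ?_⟩
  let x : ℕ ↪ X := Infinite.natEmbedding X
  -- Omitting `x n` marks the tolerance: once `V k` contains `x 0, …, x (N - 1)`, its index is at
  -- least `N`. A finite `E` still fits in a member, by taking `n` with `x n ∉ E`.
  let 𝒰 : Set (Set X) := {V | ∃ n : ℕ, ∃ f ∈ B,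
    V = {y | dist (f.1 y) (h.1 y) < 1 / ((n : ℝ) + 1)} \ {x n}}
  obtain ⟨V, hV, hVlim⟩ := hX 𝒰
    (by
      rintro _ ⟨n, f, -, rfl⟩
      exact (isOpen_lt ((hHc _ f.2).dist (hHc _ h.2)) continuous_const).sdiff isClosed_singleton)
    (by
      intro E hE
      obtain ⟨n, hn⟩ := (hE.preimage x.injective.injOn).exists_notMem
      obtain ⟨f, hf, hfE⟩ := mem_closure_iff_forall_finset_dist.1 hh hE.toFinset n
      exact ⟨_, ⟨n, f, hf, rfl⟩, fun y hy =>
        ⟨hfE y (hE.mem_toFinset.2 hy), fun hyx => hn (by rw [mem_preimage, ← hyx]; exact hy)⟩⟩)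
  have hev : ∀ y, ∀ᶠ k in atTop, y ∈ V k := fun y => by
    have hy : y ∈ ⋃ n, ⋂ i, ⋂ (_ : n ≤ i), V i := hVlim ▸ mem_univ y
    obtain ⟨N, hN⟩ := mem_iUnion.1 hy
    exact eventually_atTop.2 ⟨N, mem_iInter₂.1 hN⟩
  choose n f hfB hVeq using hV
  have hn : Tendsto n atTop atTop := by
    refine tendsto_atTop.2 fun N => ?_
    have : ∀ᶠ k in atTop, ∀ j ∈ Finset.range N, x j ∈ V k :=
      (Finset.range N).eventually_all.2 fun j _ => hev (x j)
    filter_upwards [this] with k hk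
    by_contra! hlt
    have := hk (n k) (Finset.mem_range.2 hlt)
    rw [hVeq] at this
    exact this.2 rfl
  refine ⟨f, hfB, ?_⟩
  rw [tendsto_subtype_rng, tendsto_pi_nhds]
  intro y
  rw [tendsto_iff_dist_tendsto_zero]
  refine squeeze_zero' (Eventually.of_forall fun _ => dist_nonneg) ?_
    (tendsto_one_div_add_atTop_nhds_zero_nat.comp hn)
  filter_upwards [hev y] with k hk
  rw [hVeq] at hk
  exact hk.1.le

theorem theoremt {X Y : Type*} [TopologicalSpace X] [TopologicalSpace Y]
    [TopologicalSpace.MetrizableSpace Y] [NoncompactSpace Y]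
    (hX : IsTychonoffFor X Y)
    (g : ℕ → Y) (hg_inj : Function.Injective g)
    (hg_closed : IsClosed (range g)) (hg_discrete : DiscreteTopology (range g))
    (H : Set (X → Y))
    (hH : IsRelativelyTychonoff (range g) H {f : X → Y | Continuous f})
    (hg₀ : (fun _ : X => g 0) ∈ H) :
    List.TFAE [
      FrechetUrysohnSpace H,
      SequentialSpace H,
      CompactlyCoherentSpace H,
      HasPropertyGamma X] := by
  let _ := TopologicalSpace.metrizableSpaceMetric Y
  tfae_have 1 → 2 := fun _ => inferInstance
  tfae_have 2 → 3 := fun _ => inferInstance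
  tfae_have 3 → 4 := fun _ =>
    hasPropertyGamma_of_compactlyCoherentSpace hg_inj hg_closed hg_discrete hH hg₀
  tfae_have 4 → 1 := fun hγ => by
    have : Nontrivial Y := hg_inj.nontrivial
    have := hX.t1Space
    exact hγ.frechetUrysohnSpace fun f hf => hH.1 hf
  tfae_finish
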